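/- Let $n\ge 1$ and let $v_1(t),\dots,v_n(t)$ be arbitrary real analytic functions defined in a neighbourhood of $0\in\mathbb R$. For $x=(x^1,\dots,x^n)\in\mathbb R^n$ and a real $n\times n$ matrix $L$ put $$M=x^1L^{n-1}+x^2L^{n-2}+\dots+x^{n-1}L+x^n\,\mathrm{Id}$$ and consider the matrix relation $$r(L,M)=L^n-v_1(M)L^{n-1}-v_2(M)L^{n-2}-\dots-v_{n-1}(M)L-v_n(M)=0, \qquad (*)$$ where $v_i(M)$ is the sum of the Taylor series of $v_i$ at $0$ evaluated at the matrix $M$. Call $L$ $\mathrm{gl}$-regular if $\mathrm{Id},L,\dots,L^{n-1}$ are linearly independent, and call the numbers $c_1,\dots,c_n$ defined by $\det(\lambda\,\mathrm{Id}-L)=\lambda^n-c_1\lambda^{n-1}-\dots-c_n$ the characteristic coefficients of $L$. Then there are functions $f_1(x),\dots,f_n(x)$, real analytic in a neighbourhood of $x=0$, such that: 1. The relation $(*)$ determines the characteristic coefficients uniquely as $f_1(x),\dots,f_n(x)$ near $x=0$. That is, for all $x$ sufficiently close to $0$, there are $\mathrm{gl}$-regular matrices with characteristic coefficients $f_1(x),\dots,f_n(x)$,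 and each of them satisfies $(*)$. Conversely, for every $R$ and all $x$ sufficiently close to $0$ (depending on $R$), if $L$ is a $\mathrm{gl}$-regular matrix whose characteristic coefficients are bounded by $R$ in absolute value, then the matrices $v_i(M)$ are well defined (the series converge), and if $(*)$ holds, then the characteristic coefficients of $L$ are $f_1(x),\dots,f_n(x)$. 2. In a neighbourhood of $x=0$ these functions satisfy, for $1\le i,j\le n-1$, $$\frac{\partial f_i}{\partial x^j}=f_i\frac{\partial f_1}{\partial x^{j+1}}+\frac{\partial f_{i+1}}{\partial x^{j+1}},\qquad \frac{\partial f_n}{\partial x^j}=f_n\frac{\partial f_1}{\partial x^{j+1}},$$ and the initial condition $f_i(0,\dots,0,x^n)=v_i(x^n)$ for $i=1,\dots,n$ and all $x^n$ sufficiently close to $0$. -/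

import Mathlib

open Filter Topology

/-- `L` is `gl`-regular: the matrices `Id, L, …, L^(n-1)` are linearly independent. -/
def GLRegular {n : ℕ} (L : Matrix (Fin n) (Fin n) ℝ) : Prop :=
  LinearIndependent ℝ (fun k : Fin n => L ^ (k : ℕ))

/-- The coefficients `f_1, …, f_n` of the characteristic polynomial
`det (λ Id - L) = λ^n - f_1 λ^(n-1) - … - f_n`. The index `i : Fin n` stands for `i + 1`
in the numbering from `1` to `n`, here and below. -/
noncomputable def charCoeffs {n : ℕ} (L : Matrix (Fin n) (Fin n) ℝ) : Fin n → ℝ :=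
  fun i => -(L.charpoly.coeff (n - 1 - (i : ℕ)))

/-- The matrix `M = x^1 L^(n-1) + x^2 L^(n-2) + … + x^n Id`. -/
noncomputable def matM {n : ℕ} (x : Fin n → ℝ) (L : Matrix (Fin n) (Fin n) ℝ) : Matrix (Fin n) (Fin n) ℝ :=
  ∑ i : Fin n, x i • L ^ (n - 1 - (i : ℕ))

/-- `B = v(A)`, where `v` is a function of one real variable that is analytic at `0`: the Taylor
series of `v` at `0`, evaluated at the matrix `A`, converges to `B`. -/
def IsMatrixValue {n : ℕ} (v : ℝ → ℝ) (A B : Matrix (Fin n) (Fin n) ℝ) : Prop :=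
  HasSum (fun k : ℕ => (iteratedDeriv k v 0 / (k.factorial : ℝ)) • A ^ k) B

/-- The matrix relation `r(L, M) = L^n - v_1(M) L^(n-1) - … - v_n(M) = 0` with `M = matM x L`
(all the matrices `v_i(M)` being defined). -/
def MatrixRelation {n : ℕ} (v : Fin n → ℝ → ℝ) (x : Fin n → ℝ)
    (L : Matrix (Fin n) (Fin n) ℝ) : Prop :=
  ∃ V : Fin n → Matrix (Fin n) (Fin n) ℝ,
    (∀ i, IsMatrixValue (v i) (matM x L) (V i)) ∧
      L ^ n - ∑ i : Fin n, V i * L ^ (n - 1 - (i : ℕ)) = 0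

/-- The partial derivative `∂f_i/∂x^j` at the point `x`. -/
noncomputable def partialD {n : ℕ} (f : (Fin n → ℝ) → Fin n → ℝ) (i j : Fin n)
    (x : Fin n → ℝ) : ℝ :=
  fderiv ℝ (fun y => f y i) x (Pi.single j 1)

/-- The system of partial differential equations
`∂f_i/∂x^j = f_i ∂f_1/∂x^(j+1) + ∂f_(i+1)/∂x^(j+1)`,
`∂f_n/∂x^j = f_n ∂f_1/∂x^(j+1)`, for `1 ≤ i, j ≤ n - 1`, at the point `x`. -/
def SolvesSystemAt {n : ℕ} (f : (Fin n → ℝ) → Fin n → ℝ) (x : Fin n → ℝ) : Prop :=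
  ∀ (j : ℕ) (hj : j + 1 < n),
    (∀ (i : ℕ) (hi : i + 1 < n),
      partialD f ⟨i, by omega⟩ ⟨j, by omega⟩ x
        = f x ⟨i, by omega⟩ * partialD f ⟨0, by omega⟩ ⟨j + 1, hj⟩ x
          + partialD f ⟨i + 1, hi⟩ ⟨j + 1, hj⟩ x) ∧
    partialD f ⟨n - 1, by omega⟩ ⟨j, by omega⟩ x
      = f x ⟨n - 1, by omega⟩ * partialD f ⟨0, by omega⟩ ⟨j + 1, hj⟩ x

/-- The point `(0, …, 0, t)` of `ℝ^n`. -/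
noncomputable def lastAxis (n : ℕ) (t : ℝ) : Fin n → ℝ :=
  fun k => if (k : ℕ) + 1 = n then t else 0

open scoped ContDiff

/-! Write n = m + 1, number indices from 0, and let S = `companionOp c` be multiplication by λ in
ℝ[λ]/(λ^(m+1) - c_0 λ^m - … - c_m). Reducing Σ v_i(M) λ^(m-i) in this algebra gives a vector R(x, c)
= `reducedCoeffs a x c`. For a `gl`-regular L with characteristic coefficients c, Cayley–Hamilton
turns the matrix relation into the fixed-point equation c = R(x, c), once the series converge
(`matrixRelation_iff`). Since R(0, c) does not depend on c, the implicit function theorem gives an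
analytic solution f.

The rest depends on exact divided differences. In c, R(x, c') - R(x, c) = T (c' - c) with T a
polynomial in `companionOp c'` (`reducedCoeffs_sub`). T vanishes at x = 0, so it is a contraction
for small x, uniformly for bounded c and c'; this gives uniqueness. In x, R(y, c) - R(x, c) is the
polynomial with coefficients y - x, evaluated at S and applied to a vector k
(`reducedCoeffs_sub_arg`). In the limit ∂_j f = T ∂_j f + S^(m-j) k, where k does not depend on j, T
commutes with S and ‖T‖ < 1. Hence ∂_j f = S ∂_(j+1) f, which in components is the required system.
-/

/-- The sum of the power series with coefficients `a`, evaluated in a real Banach algebra. -/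
noncomputable def powerSum {A : Type*} [NormedRing A] [NormedAlgebra ℝ A] (a : ℕ → ℝ) (X : A) : A :=
  ∑' k, a k • X ^ k

/-- The polynomial `u_0 X^m + u_1 X^(m-1) + … + u_m` evaluated in an algebra. -/
def revPoly {m : ℕ} {A : Type*} [Ring A] [Algebra ℝ A] (X : A) (u : Fin (m + 1) → ℝ) : A :=
  ∑ i, u i • X ^ (m - (i : ℕ))

/-! ### Power series in a real Banach algebra -/

section Series

variable {A : Type*} [NormedRing A] [NormedAlgebra ℝ A]

theorem radius_ofScalars_le [NormOneClass A] (a : ℕ → ℝ) :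
    (FormalMultilinearSeries.ofScalars ℝ a).radius ≤
      (FormalMultilinearSeries.ofScalars A a).radius := by
  refine FormalMultilinearSeries.radius_le_of_le (fun k => ?_)
  rw [FormalMultilinearSeries.ofScalars_norm, FormalMultilinearSeries.ofScalars_norm]

theorem hasFPowerSeriesAt_powerSum [CompleteSpace A] [NormOneClass A] {a : ℕ → ℝ}
    (ha : 0 < (FormalMultilinearSeries.ofScalars ℝ a).radius) :
    HasFPowerSeriesAt (powerSum a : A → A) (FormalMultilinearSeries.ofScalars A a) 0 := by
  have h := (FormalMultilinearSeries.ofScalars A a).hasFPowerSeriesOnBall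
    (ha.trans_le (radius_ofScalars_le a))
  have e : (FormalMultilinearSeries.ofScalars A a).sum = powerSum a := by
    funext X
    exact FormalMultilinearSeries.ofScalars_sum_eq a X
  rw [e] at h
  exact h.hasFPowerSeriesAt

theorem contDiffAt_powerSum [CompleteSpace A] [NormOneClass A] {a : ℕ → ℝ}
    (ha : 0 < (FormalMultilinearSeries.ofScalars ℝ a).radius) :
    ContDiffAt ℝ ω (powerSum a : A → A) 0 :=
  (hasFPowerSeriesAt_powerSum ha).analyticAt.contDiffAt

theorem eventually_hasSum_powerSum [CompleteSpace A] [NormOneClass A] {a : ℕ → ℝ}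
    (ha : 0 < (FormalMultilinearSeries.ofScalars ℝ a).radius) :
    ∀ᶠ X in 𝓝 (0 : A), HasSum (fun k => a k • X ^ k) (powerSum a X) := by
  filter_upwards [(hasFPowerSeriesAt_powerSum (A := A) ha).eventually_hasSum] with X hX
  simpa [FormalMultilinearSeries.ofScalars_apply_eq] using hX

theorem eventually_continuousAt_powerSum [CompleteSpace A] [NormOneClass A] {a : ℕ → ℝ}
    (ha : 0 < (FormalMultilinearSeries.ofScalars ℝ a).radius) :
    ∀ᶠ X in 𝓝 (0 : A), ContinuousAt (powerSum a) X :=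
  (hasFPowerSeriesAt_powerSum ha).analyticAt.eventually_continuousAt

theorem powerSum_zero (a : ℕ → ℝ) : powerSum a (0 : A) = a 0 • 1 := by
  rw [powerSum, tsum_eq_single 0 (fun k hk => by simp [hk])]
  simp

end Series

/-! ### Intertwining maps between modules -/

section Intertwining

variable {A B V W : Type*} [Ring A] [Ring B]
  [AddCommGroup V] [Module ℝ V] [Module A V] [AddCommGroup W] [Module ℝ W] [Module B W]

theorem intertwine_pow {ψ : V →ₗ[ℝ] W} {X : A} {Y : B} (h : ∀ u, ψ (X • u) = Y • ψ u) (k : ℕ)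
    (u : V) : ψ (X ^ k • u) = Y ^ k • ψ u := by
  induction k generalizing u with
  | zero => simp
  | succ k ih => rw [pow_succ, pow_succ, mul_smul, mul_smul, ih, h]

theorem intertwine_revPoly [Algebra ℝ A] [Algebra ℝ B] [IsScalarTower ℝ A V]
    [IsScalarTower ℝ B W] {m : ℕ} {ψ : V →ₗ[ℝ] W} {X : A} {Y : B}
    (h : ∀ u, ψ (X • u) = Y • ψ u) (x : Fin (m + 1) → ℝ) (u : V) :
    ψ (revPoly X x • u) = revPoly Y x • ψ u := by
  simp only [revPoly, Finset.sum_smul, map_sum, smul_assoc, map_smul, intertwine_pow h]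

end Intertwining

/-! ### Functional calculus and intertwining of bounded operators -/

section Operators

variable {V W : Type*} [NormedAddCommGroup V] [NormedSpace ℝ V]
  [NormedAddCommGroup W] [NormedSpace ℝ W]

instance : IsScalarTower ℝ (V →L[ℝ] V) V := ⟨fun _ _ _ => rfl⟩

theorem intertwine_operator_pow {X : V →L[ℝ] V} {Y : W →L[ℝ] W} {ψ : V →L[ℝ] W}
    (h : ∀ u, ψ (X u) = Y (ψ u)) (k : ℕ) (u : V) : ψ ((X ^ k) u) = (Y ^ k) (ψ u) := by
  induction k generalizing u with
  | zero => simp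
  | succ k ih => simp only [pow_succ, mul_apply_eq_comp, ih, h]

theorem intertwine_operator_revPoly {m : ℕ} {X : V →L[ℝ] V} {Y : W →L[ℝ] W} {ψ : V →L[ℝ] W}
    (h : ∀ u, ψ (X u) = Y (ψ u)) (x : Fin (m + 1) → ℝ) (u : V) :
    ψ (revPoly X x u) = revPoly Y x (ψ u) := by
  simp only [revPoly, sum_apply, smul_apply, map_sum, map_smul, intertwine_operator_pow h]

theorem hasSum_powerSum_apply {a : ℕ → ℝ} {X : V →L[ℝ] V}
    (hX : HasSum (fun k => a k • X ^ k) (powerSum a X)) (u : V) :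
    HasSum (fun k => a k • (X ^ k) u) (powerSum a X u) := by
  simpa using (ContinuousLinearMap.apply ℝ V u).hasSum hX

/-- The source of all divided-difference formulas below: suitable intertwiners out of a block
operator on V × V compare a function of one operator with the same function of another. -/
theorem intertwine_powerSum {a : ℕ → ℝ} {X : V →L[ℝ] V} {Y : W →L[ℝ] W} (ψ : V →L[ℝ] W)
    (h : ∀ u, ψ (X u) = Y (ψ u)) (hX : HasSum (fun k => a k • X ^ k) (powerSum a X))
    (hY : HasSum (fun k => a k • Y ^ k) (powerSum a Y)) (u : V) :
    ψ (powerSum a X u) = powerSum a Y (ψ u) := by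
  have h1 := ψ.hasSum (hasSum_powerSum_apply hX u)
  simp only [map_smul, intertwine_operator_pow h] at h1
  exact h1.unique (hasSum_powerSum_apply hY (ψ u))

end Operators

/-! ### Polynomials with coefficients in decreasing order -/

section RevPoly

variable {m : ℕ} {A : Type*} [Ring A] [Algebra ℝ A]

/-- `revPoly X u` as a linear function of the coefficients `u`. -/
def revPolyLin (X : A) : (Fin (m + 1) → ℝ) →ₗ[ℝ] A where
  toFun := revPoly X
  map_add' u w := by simp [revPoly, add_smul, Finset.sum_add_distrib]
  map_smul' r u := by simp [revPoly, Finset.smul_sum, mul_smul]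

theorem revPoly_zero (X : A) : revPoly X (0 : Fin (m + 1) → ℝ) = 0 := by simp [revPoly]

theorem revPoly_sub (X : A) (u w : Fin (m + 1) → ℝ) :
    revPoly X (u - w) = revPoly X u - revPoly X w := (revPolyLin X).map_sub u w

theorem revPoly_single (X : A) (i : Fin (m + 1)) (r : ℝ) :
    revPoly X (Pi.single i r) = r • X ^ (m - (i : ℕ)) := by
  rw [revPoly, Finset.sum_eq_single i (fun j _ hj => by simp [hj]) (by simp)]
  simp

theorem Commute.revPoly_right {X Y : A} (h : Commute Y X) (u : Fin (m + 1) → ℝ) :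
    Commute Y (revPoly X u) :=
  Commute.sum_right _ _ _ fun _ _ => (h.pow_right _).smul_right _

theorem commute_revPoly (X : A) (u w : Fin (m + 1) → ℝ) : Commute (revPoly X u) (revPoly X w) :=
  ((Commute.refl X).revPoly_right u).symm.revPoly_right w

end RevPoly

/-! ### The companion operator -/

section Companion

variable {m : ℕ}

/-- The left shift `(u_0, …, u_m) ↦ (u_1, …, u_m, 0)`. -/
noncomputable def shiftOp (m : ℕ) : (Fin (m + 1) → ℝ) →L[ℝ] (Fin (m + 1) → ℝ) :=
  LinearMap.toContinuousLinearMap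
    { toFun := fun u => Fin.snoc (α := fun _ => ℝ) (fun i : Fin m => u i.succ) 0
      map_add' := fun u w => by
        ext i; refine Fin.lastCases ?_ (fun j => ?_) i <;> simp
      map_smul' := fun r u => by
        ext i; refine Fin.lastCases ?_ (fun j => ?_) i <;> simp }

@[simp]
theorem shiftOp_castSucc (u : Fin (m + 1) → ℝ) (i : Fin m) :
    shiftOp m u i.castSucc = u i.succ := by simp [shiftOp]

@[simp]
theorem shiftOp_last (u : Fin (m + 1) → ℝ) : shiftOp m u (Fin.last m) = 0 := by simp [shiftOp]

/-- Multiplication by `λ` modulo `λ^(m+1) - c_0 λ^m - … - c_m`, in the basis `λ^m, …, λ, 1`. -/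
noncomputable def companionOp (c : Fin (m + 1) → ℝ) :
    (Fin (m + 1) → ℝ) →L[ℝ] (Fin (m + 1) → ℝ) :=
  shiftOp m + (ContinuousLinearMap.proj (R := ℝ) (φ := fun _ : Fin (m + 1) => ℝ) 0).smulRight c

theorem companionOp_apply (c u : Fin (m + 1) → ℝ) :
    companionOp c u = shiftOp m u + u 0 • c := rfl

theorem companionOp_castSucc (c u : Fin (m + 1) → ℝ) (i : Fin m) :
    companionOp c u i.castSucc = u i.succ + u 0 * c i.castSucc := by
  simp [companionOp_apply]

theorem companionOp_last (c u : Fin (m + 1) → ℝ) :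
    companionOp c u (Fin.last m) = u 0 * c (Fin.last m) := by
  simp [companionOp_apply]

theorem companionOp_single_zero (c : Fin (m + 1) → ℝ) : companionOp c (Pi.single 0 1) = c := by
  ext i
  refine Fin.lastCases ?_ (fun j => ?_) i
  · simp [companionOp_last]
  · simp [companionOp_castSucc]

theorem companionOp_single_succ (c : Fin (m + 1) → ℝ) (i : Fin m) :
    companionOp c (Pi.single i.succ 1) = Pi.single i.castSucc 1 := by
  ext k
  refine Fin.lastCases ?_ (fun j => ?_) k
  · simp [companionOp_last, (Fin.castSucc_lt_last i).ne', (Fin.succ_ne_zero i).symm]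
  · simp [companionOp_castSucc, Pi.single_apply, (Fin.succ_ne_zero i).symm]

/-- The last basis vector represents 1, so it is cyclic for multiplication by λ. -/
theorem companionOp_pow_single_last (c : Fin (m + 1) → ℝ) (i : Fin (m + 1)) :
    (companionOp c ^ (m - (i : ℕ))) (Pi.single (Fin.last m) 1) = Pi.single i 1 := by
  refine Fin.reverseInduction ?_ (fun j ih => ?_) i
  · simp
  · have e : m - (j.castSucc : ℕ) = (m - (j.succ : ℕ)) + 1 := by
      have := j.2
      simp; omega
    rw [e, pow_succ', mul_apply_eq_comp, ih, companionOp_single_succ]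

theorem revPoly_companionOp_single_last (c u : Fin (m + 1) → ℝ) :
    revPoly (companionOp c) u (Pi.single (Fin.last m) 1) = u := by
  simp only [revPoly, sum_apply, smul_apply,
    companionOp_pow_single_last]
  exact (pi_eq_sum_univ' u).symm

theorem companionOp_pow_succ_single_last (c : Fin (m + 1) → ℝ) :
    (companionOp c ^ (m + 1)) (Pi.single (Fin.last m) 1) = c := by
  have h := companionOp_pow_single_last c 0
  rw [Fin.val_zero, Nat.sub_zero] at h
  rw [pow_succ', mul_apply_eq_comp, h, companionOp_single_zero]

/-- Both sides commute with every polynomial in the companion operator and agree on the cyclic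
vector, whose images under such polynomials fill the space. -/
theorem companionOp_pow_succ (c : Fin (m + 1) → ℝ) :
    companionOp c ^ (m + 1) = revPoly (companionOp c) c := by
  ext1 w
  set S := companionOp c
  set e : Fin (m + 1) → ℝ := Pi.single (Fin.last m) 1
  have h1 : (S ^ (m + 1)) (revPoly S w e) = revPoly S w ((S ^ (m + 1)) e) :=
    DFunLike.congr_fun (((Commute.refl S).pow_left (m + 1)).revPoly_right w).eq e
  have h2 : revPoly S c (revPoly S w e) = revPoly S w (revPoly S c e) :=
    DFunLike.congr_fun (commute_revPoly S c w).eq e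
  rw [companionOp_pow_succ_single_last] at h1
  rw [revPoly_companionOp_single_last c c] at h2
  rw [← h1, revPoly_companionOp_single_last] at h2
  exact h2.symm

/-- The evaluation λ ↦ X factors through the quotient algebra, so it carries multiplication by λ to
multiplication by X. -/
theorem revPoly_companionOp_apply {A : Type*} [Ring A] [Algebra ℝ A] {X : A}
    {c : Fin (m + 1) → ℝ} (hX : X ^ (m + 1) = revPoly X c) (u : Fin (m + 1) → ℝ) :
    revPoly X (companionOp c u) = X * revPoly X u := by
  have h1 : revPoly X (shiftOp m u) = ∑ i : Fin m, u i.succ • X ^ (m - (i : ℕ)) := by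
    simp [revPoly, Fin.sum_univ_castSucc]
  have h2 : X * revPoly X u = u 0 • X ^ (m + 1) + ∑ i : Fin m, u i.succ • X ^ (m - (i : ℕ)) := by
    rw [revPoly, Fin.sum_univ_succ, mul_add, Finset.mul_sum]
    congr 1
    · simp [pow_succ']
    · refine Finset.sum_congr rfl fun i _ => ?_
      have e : m - (i : ℕ) = (m - (i.succ : ℕ)) + 1 := by
        have := i.2
        simp; omega
      rw [mul_smul_comm, ← pow_succ', ← e]
  have h3 : revPoly X (companionOp c u) = revPoly X (shiftOp m u) + u 0 • revPoly X c := by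
    rw [companionOp_apply]
    exact ((revPolyLin X).map_add _ _).trans (congrArg _ ((revPolyLin X).map_smul _ _))
  rw [h3, h1, h2, hX, add_comm]

end Companion

/-! ### Cayley–Hamilton and `gl`-regular matrices -/

section Cayley

variable {m : ℕ}

theorem pow_succ_eq_revPoly_charCoeffs (L : Matrix (Fin (m + 1)) (Fin (m + 1)) ℝ) :
    L ^ (m + 1) = revPoly L (charCoeffs L) := by
  have h := L.aeval_self_charpoly
  have hd : L.charpoly.natDegree = m + 1 := by simp
  have hm : L.charpoly.coeff (m + 1) = 1 := by
    have := L.charpoly_monic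
    rwa [Polynomial.Monic, Polynomial.leadingCoeff, hd] at this
  rw [Polynomial.aeval_eq_sum_range, hd, Finset.sum_range_succ, hm, one_smul,
    ← Finset.sum_range_reflect] at h
  rw [eq_neg_of_add_eq_zero_right h, revPoly, Finset.sum_range, ← Finset.sum_neg_distrib]
  exact Finset.sum_congr rfl fun i _ => by simp [charCoeffs]

theorem matM_eq_revPoly (x : Fin (m + 1) → ℝ) (L : Matrix (Fin (m + 1)) (Fin (m + 1)) ℝ) :
    matM x L = revPoly L x := by simp [matM, revPoly]

theorem GLRegular.revPoly_injective {L : Matrix (Fin (m + 1)) (Fin (m + 1)) ℝ}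
    (hL : GLRegular L) : Function.Injective (revPoly (m := m) L) := by
  refine (injective_iff_map_eq_zero (revPolyLin (m := m) L)).2 fun u hu => ?_
  have h := Fintype.linearIndependent_iff.1 hL (fun i => u i.rev) ?_
  · ext i
    simpa using h i.rev
  · change revPoly L u = 0 at hu
    rw [← Equiv.sum_comp Fin.revPerm]
    simpa [revPoly, Fin.val_rev] using hu

/-- The companion matrix works: a polynomial in it of degree at most m is recovered from its value
on the cyclic vector. This gives independence of the powers and, through Cayley–Hamilton, the
characteristic coefficients. -/
theorem exists_glRegular_charCoeffs_eq (c : Fin (m + 1) → ℝ) :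
    ∃ L : Matrix (Fin (m + 1)) (Fin (m + 1)) ℝ, GLRegular L ∧ charCoeffs L = c := by
  let e : Fin (m + 1) → ℝ := Pi.single (Fin.last m) 1
  let L := LinearMap.toMatrix' (companionOp c : (Fin (m + 1) → ℝ) →ₗ[ℝ] (Fin (m + 1) → ℝ))
  have hL : ∀ u, L.mulVec u = companionOp c u := fun u =>
    LinearMap.toMatrix'_mulVec _ u
  have hpow : ∀ k u, (L ^ k).mulVec u = (companionOp c ^ k) u := by
    intro k
    induction k with
    | zero => simp
    | succ k ih =>
      intro u
      rw [pow_succ, pow_succ, ← Matrix.mulVec_mulVec, hL, ih, mul_apply_eq_comp]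
  have hrev : ∀ u, (revPoly L u).mulVec e = u := by
    intro u
    conv_rhs => rw [← revPoly_companionOp_single_last c u]
    simp only [revPoly, Matrix.sum_mulVec, Matrix.smul_mulVec, hpow,
      sum_apply, smul_apply, e]
  refine ⟨L, ?_, ?_⟩
  · refine Fintype.linearIndependent_iff.2 fun g hg => ?_
    have h : revPoly L (fun i => g i.rev) = 0 := by
      rw [← hg, ← Equiv.sum_comp Fin.revPerm]
      simp [revPoly, Fin.val_rev]
    have h' := hrev (fun i => g i.rev)
    rw [h, Matrix.zero_mulVec] at h'
    intro i
    simpa using (congrFun h' i.rev).symm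
  · have h := congrArg (fun N => N.mulVec e) (pow_succ_eq_revPoly_charCoeffs L)
    simp only [hrev, hpow, e, companionOp_pow_succ_single_last] at h
    exact h.symm

end Cayley

/-! ### The matrix relation as a fixed-point equation -/

section Relation

variable {m : ℕ}

/-- The coefficients of `v_0(M) λ^m + … + v_m(M)` reduced modulo `λ^(m+1) - c_0 λ^m - … - c_m`, where
`M = x_0 λ^m + … + x_m` and `v_i` has Taylor coefficients `a i`. -/
noncomputable def reducedCoeffs (a : Fin (m + 1) → ℕ → ℝ) (x c : Fin (m + 1) → ℝ) :
    Fin (m + 1) → ℝ :=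
  ∑ i, powerSum (a i) (revPoly (companionOp c) x) (Pi.single i 1)

/-- The evaluation λ ↦ L is linear on a finite-dimensional space, hence continuous, and transports
the convergent series from the quotient algebra to matrices. -/
theorem hasSum_matM_pow_mul {a : ℕ → ℝ} {x : Fin (m + 1) → ℝ}
    {L : Matrix (Fin (m + 1)) (Fin (m + 1)) ℝ}
    (h : HasSum (fun k => a k • (revPoly (companionOp (charCoeffs L)) x) ^ k)
      (powerSum a (revPoly (companionOp (charCoeffs L)) x))) (u : Fin (m + 1) → ℝ) :
    HasSum (fun k => a k • ((matM x L) ^ k * revPoly L u))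
      (revPoly L (powerSum a (revPoly (companionOp (charCoeffs L)) x) u)) := by
  have h1 := (hasSum_powerSum_apply h u).map (revPolyLin L)
    (revPolyLin L).continuous_of_finiteDimensional
  have hS : ∀ u, revPolyLin (m := m) L (companionOp (charCoeffs L) • u) = L • revPolyLin L u :=
    fun u => revPoly_companionOp_apply (pow_succ_eq_revPoly_charCoeffs L) u
  have h2 : ∀ k, revPoly L (((revPoly (companionOp (charCoeffs L)) x) ^ k) u) =
      matM x L ^ k * revPoly L u := by
    intro k
    rw [matM_eq_revPoly]
    exact intertwine_pow (ψ := revPolyLin L) (fun u => intertwine_revPoly hS x u) k u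
  convert h1 using 1
  swap
  · rfl
  funext k
  exact ((congrArg _ (h2 k).symm).trans ((revPolyLin L).map_smul _ _).symm)

theorem revPoly_single_last {A : Type*} [Ring A] [Algebra ℝ A] (X : A) :
    revPoly X (Pi.single (Fin.last m) 1) = 1 := by simp [revPoly_single]

theorem isMatrixValue_of_hasSum {v : ℝ → ℝ} {x : Fin (m + 1) → ℝ}
    {L : Matrix (Fin (m + 1)) (Fin (m + 1)) ℝ}
    (h : HasSum (fun k => (iteratedDeriv k v 0 / (k.factorial : ℝ)) •
        (revPoly (companionOp (charCoeffs L)) x) ^ k)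
      (powerSum (fun k => iteratedDeriv k v 0 / (k.factorial : ℝ))
        (revPoly (companionOp (charCoeffs L)) x))) :
    IsMatrixValue v (matM x L) (revPoly L (powerSum
      (fun k => iteratedDeriv k v 0 / (k.factorial : ℝ))
      (revPoly (companionOp (charCoeffs L)) x) (Pi.single (Fin.last m) 1))) := by
  simpa [IsMatrixValue, revPoly_single_last] using
    hasSum_matM_pow_mul h (Pi.single (Fin.last m) 1)

theorem matrixRelation_iff {v : Fin (m + 1) → ℝ → ℝ} {x : Fin (m + 1) → ℝ}
    {L : Matrix (Fin (m + 1)) (Fin (m + 1)) ℝ} (hL : GLRegular L)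
    (h : ∀ i, HasSum (fun k => (iteratedDeriv k (v i) 0 / (k.factorial : ℝ)) •
        (revPoly (companionOp (charCoeffs L)) x) ^ k)
      (powerSum (fun k => iteratedDeriv k (v i) 0 / (k.factorial : ℝ))
        (revPoly (companionOp (charCoeffs L)) x))) :
    MatrixRelation v x L ↔ charCoeffs L =
      reducedCoeffs (fun i k => iteratedDeriv k (v i) 0 / (k.factorial : ℝ)) x (charCoeffs L) := by
  have key : ∀ V : Fin (m + 1) → Matrix (Fin (m + 1)) (Fin (m + 1)) ℝ,
      (∀ i, IsMatrixValue (v i) (matM x L) (V i)) →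
      (L ^ (m + 1) - ∑ i : Fin (m + 1), V i * L ^ (m + 1 - 1 - (i : ℕ)) = 0 ↔ charCoeffs L =
        reducedCoeffs (fun i k => iteratedDeriv k (v i) 0 / (k.factorial : ℝ)) x
          (charCoeffs L)) := by
    intro V hV
    have e : ∑ i : Fin (m + 1), V i * L ^ (m + 1 - 1 - (i : ℕ)) =
        revPoly L (reducedCoeffs (fun i k => iteratedDeriv k (v i) 0 / (k.factorial : ℝ)) x
          (charCoeffs L)) := by
      refine Eq.trans (Finset.sum_congr rfl fun i _ => ?_)
        (map_sum (revPolyLin (m := m) L) _ _).symm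
      have h1 := hasSum_matM_pow_mul (h i) (Pi.single i 1)
      have h2 := (hV i).mul_right (L ^ (m + 1 - 1 - (i : ℕ)))
      simp only [revPoly_single, one_smul, ← smul_mul_assoc] at h1
      -- Limits are unique, so any admissible value of v_i(M) may be replaced by the one computed in
      -- the quotient algebra.
      exact h2.unique h1
    rw [e, pow_succ_eq_revPoly_charCoeffs, sub_eq_zero]
    exact hL.revPoly_injective.eq_iff
  constructor
  · rintro ⟨V, hV, hr⟩
    exact (key V hV).1 hr
  · intro hc
    exact ⟨_, fun i => isMatrixValue_of_hasSum (h i), (key _ fun i => isMatrixValue_of_hasSum (h i)).2 hc⟩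

end Relation

/-! ### Divided differences via block operators -/

section DividedDifferences

variable {m : ℕ}

/-- The operator `(p, q) ↦ (S' p + q_0 • 1, S q)`, whose functions compute the divided differences in
the characteristic coefficients. -/
noncomputable def coeffBlock (c c' : Fin (m + 1) → ℝ) :
    ((Fin (m + 1) → ℝ) × (Fin (m + 1) → ℝ)) →L[ℝ] ((Fin (m + 1) → ℝ) × (Fin (m + 1) → ℝ)) :=
  ((companionOp c').comp (ContinuousLinearMap.fst ℝ _ _) +
    ((ContinuousLinearMap.proj (R := ℝ) (φ := fun _ : Fin (m + 1) => ℝ) 0).comp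
      (ContinuousLinearMap.snd ℝ _ _)).smulRight (Pi.single (Fin.last m) 1)).prod
  ((companionOp c).comp (ContinuousLinearMap.snd ℝ _ _))

theorem coeffBlock_apply (c c' : Fin (m + 1) → ℝ) (p : (Fin (m + 1) → ℝ) × (Fin (m + 1) → ℝ)) :
    coeffBlock c c' p =
      (companionOp c' p.1 + p.2 0 • Pi.single (Fin.last m) 1, companionOp c p.2) := rfl

/-- The divided difference of `reducedCoeffs` in the characteristic coefficients. -/
noncomputable def coeffQuotient (a : Fin (m + 1) → ℕ → ℝ) (x c c' : Fin (m + 1) → ℝ) :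
    Fin (m + 1) → ℝ :=
  ∑ i, (powerSum (a i) (revPoly (coeffBlock c c') x) (0, Pi.single i 1)).1

/-- Convergence of the series of coefficients `a i` at `X`. -/
def SeriesConverge {V : Type*} [NormedAddCommGroup V] [NormedSpace ℝ V]
    (a : Fin (m + 1) → ℕ → ℝ) (X : V →L[ℝ] V) : Prop :=
  ∀ i, HasSum (fun k => a i k • X ^ k) (powerSum (a i) X)

theorem reducedCoeffs_sub {a : Fin (m + 1) → ℕ → ℝ} {x c c' : Fin (m + 1) → ℝ}
    (h : SeriesConverge a (revPoly (companionOp c) x))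
    (h' : SeriesConverge a (revPoly (companionOp c') x))
    (hb : SeriesConverge a (revPoly (coeffBlock c c') x)) :
    reducedCoeffs a x c' - reducedCoeffs a x c =
      revPoly (companionOp c') (coeffQuotient a x c c') (c' - c) := by
  let V := Fin (m + 1) → ℝ
  obtain ⟨Ψ, hΨ⟩ : ∃ Ψ : (V × V) →L[ℝ] V, ∀ p,
      Ψ p = revPoly (companionOp c') p.1 (c' - c) + p.2 := ⟨(LinearMap.toContinuousLinearMap
      (((ContinuousLinearMap.apply ℝ V (c' - c)) : (V →L[ℝ] V) →ₗ[ℝ] V) ∘ₗ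
        revPolyLin (companionOp c'))).comp (ContinuousLinearMap.fst ℝ V V) +
      ContinuousLinearMap.snd ℝ V V, fun p => rfl⟩
  -- With S = `companionOp c` and S' = `companionOp c'`, the term q_0 • 1 in the block accounts for
  -- S' q - S q = q_0 (c' - c).
  have hS : ∀ p, Ψ (coeffBlock c c' p) = companionOp c' (Ψ p) := by
    intro p
    have h1 : revPoly (companionOp c') (companionOp c' p.1 + p.2 0 • Pi.single (Fin.last m) 1) =
        companionOp c' * revPoly (companionOp c') p.1 + p.2 0 • 1 := by
      rw [← revPoly_companionOp_apply (companionOp_pow_succ c'),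
        ← revPoly_single_last (companionOp c')]
      exact ((revPolyLin _).map_add _ _).trans (congrArg _ ((revPolyLin _).map_smul _ _))
    rw [hΨ, hΨ, coeffBlock_apply, h1, map_add]
    rw [companionOp_apply c p.2, companionOp_apply c' p.2]
    simp only [add_apply, mul_apply_eq_comp, smul_apply, one_apply_eq_self, smul_sub]
    abel
  have hR := intertwine_operator_revPoly hS x
  have hsnd := intertwine_operator_revPoly (ψ := ContinuousLinearMap.snd ℝ V V)
    (X := coeffBlock c c') (Y := companionOp c) (fun _ => rfl) x
  have key : ∀ i, powerSum (a i) (revPoly (companionOp c') x) (Pi.single i 1) =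
      revPoly (companionOp c')
        (powerSum (a i) (revPoly (coeffBlock c c') x) (0, Pi.single i 1)).1 (c' - c) +
      powerSum (a i) (revPoly (companionOp c) x) (Pi.single i 1) := by
    intro i
    -- At (0, u) the map Ψ returns u. After the series is applied, the second component is its value
    -- at c, and the first holds the coefficients of the divided difference.
    have h1 := intertwine_powerSum Ψ hR (hb i) (h' i) (0, Pi.single i 1)
    have h2 := intertwine_powerSum (ContinuousLinearMap.snd ℝ V V) hsnd (hb i) (h i)
      (0, Pi.single i 1)
    simp only [hΨ, ContinuousLinearMap.coe_snd'] at h1 h2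
    rw [h2, revPoly_zero, zero_apply, zero_add] at h1
    exact h1.symm
  have hsum : revPoly (companionOp c') (coeffQuotient a x c c') (c' - c) = ∑ i, revPoly
      (companionOp c') (powerSum (a i) (revPoly (coeffBlock c c') x) (0, Pi.single i 1)).1
        (c' - c) := by
    rw [← sum_apply]
    exact DFunLike.congr_fun (map_sum (revPolyLin (companionOp c')) _ _) _
  rw [hsum, reducedCoeffs, reducedCoeffs, sub_eq_iff_eq_add, ← Finset.sum_add_distrib]
  exact Finset.sum_congr rfl fun i _ => key i

/-- The operator `(p, q) ↦ (N p + ε q, M q)`, whose functions compute the divided differences in an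
operator argument. -/
noncomputable def scaledBlock {V : Type*} [NormedAddCommGroup V] [NormedSpace ℝ V] (ε : ℝ)
    (M N : V →L[ℝ] V) : (V × V) →L[ℝ] (V × V) :=
  (N.comp (ContinuousLinearMap.fst ℝ V V) + ε • ContinuousLinearMap.snd ℝ V V).prod
    (M.comp (ContinuousLinearMap.snd ℝ V V))

/-- The map (p, q) ↦ ε⁻¹ (N - M) p + q intertwines the block with N because M and N commute, while
the second projection intertwines it with M. -/
theorem powerSum_sub_of_commute {V : Type*} [NormedAddCommGroup V] [NormedSpace ℝ V] {ε : ℝ}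
    (hε : ε ≠ 0) {M N : V →L[ℝ] V} (hMN : Commute M N) {a : ℕ → ℝ}
    (hM : HasSum (fun k => a k • M ^ k) (powerSum a M))
    (hN : HasSum (fun k => a k • N ^ k) (powerSum a N))
    (hb : HasSum (fun k => a k • scaledBlock ε M N ^ k) (powerSum a (scaledBlock ε M N))) (u : V) :
    powerSum a N u - powerSum a M u =
      (N - M) (ε⁻¹ • (powerSum a (scaledBlock ε M N) (0, u)).1) := by
  obtain ⟨Ψ, hΨ⟩ : ∃ Ψ : (V × V) →L[ℝ] V, ∀ p, Ψ p = ε⁻¹ • (N p.1 - M p.1) + p.2 :=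
    ⟨(ε⁻¹ • (N - M)).comp (ContinuousLinearMap.fst ℝ V V) + ContinuousLinearMap.snd ℝ V V,
      fun p => rfl⟩
  have hS : ∀ p, Ψ (scaledBlock ε M N p) = N (Ψ p) := by
    intro p
    have hc : M (N p.1) = N (M p.1) := DFunLike.congr_fun hMN.eq p.1
    have e : scaledBlock ε M N p = (N p.1 + ε • p.2, M p.2) := rfl
    rw [e, hΨ, hΨ]
    simp only [map_add, map_smul, map_sub, hc, smul_add, smul_sub, smul_smul, inv_mul_cancel₀ hε,
      one_smul]
    abel
  have h1 := intertwine_powerSum Ψ hS hb hN (0, u)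
  have h2 := intertwine_powerSum (ContinuousLinearMap.snd ℝ V V) (fun _ => rfl) hb hM (0, u)
  simp only [hΨ, ContinuousLinearMap.coe_snd', map_zero, sub_zero, smul_zero, zero_add] at h1 h2
  rw [← h1, h2, add_sub_cancel_right, map_smul, sub_apply]

/-- The divided difference of `reducedCoeffs` in the variable `x`. -/
noncomputable def argQuotient (a : Fin (m + 1) → ℕ → ℝ) (ε : ℝ) (x y c : Fin (m + 1) → ℝ) :
    Fin (m + 1) → ℝ :=
  ∑ i, ε⁻¹ • (powerSum (a i)
    (scaledBlock ε (revPoly (companionOp c) x) (revPoly (companionOp c) y)) (0, Pi.single i 1)).1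

theorem reducedCoeffs_sub_arg {a : Fin (m + 1) → ℕ → ℝ} {ε : ℝ} (hε : ε ≠ 0)
    {x y c : Fin (m + 1) → ℝ} (hx : SeriesConverge a (revPoly (companionOp c) x))
    (hy : SeriesConverge a (revPoly (companionOp c) y))
    (hb : SeriesConverge a
      (scaledBlock ε (revPoly (companionOp c) x) (revPoly (companionOp c) y))) :
    reducedCoeffs a y c - reducedCoeffs a x c =
      revPoly (companionOp c) (y - x) (argQuotient a ε x y c) := by
  rw [reducedCoeffs, reducedCoeffs, ← Finset.sum_sub_distrib, argQuotient, map_sum, revPoly_sub]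
  exact Finset.sum_congr rfl fun i _ =>
    powerSum_sub_of_commute hε (commute_revPoly _ _ _) (hx i) (hy i) (hb i) _

end DividedDifferences

/-! ### Convergence, continuity and contraction for small x -/

section Continuity

variable {m : ℕ}

theorem contDiff_companionOp :
    ContDiff ℝ ω (companionOp : (Fin (m + 1) → ℝ) → _) := by
  unfold companionOp
  fun_prop

variable {X : Type*} [TopologicalSpace X] {x : X}

@[fun_prop]
theorem ContinuousAt.companionOp {c : X → Fin (m + 1) → ℝ} (hc : ContinuousAt c x) :
    ContinuousAt (fun t => companionOp (c t)) x :=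
  ContinuousAt.comp (g := _root_.companionOp) contDiff_companionOp.continuous.continuousAt hc

theorem contDiff_revPoly {V : Type*} [NormedAddCommGroup V] [NormedSpace ℝ V] :
    ContDiff ℝ ω (fun p : (V →L[ℝ] V) × (Fin (m + 1) → ℝ) => revPoly p.1 p.2) := by
  unfold revPoly
  fun_prop

@[fun_prop]
theorem ContinuousAt.revPoly {V : Type*} [NormedAddCommGroup V] [NormedSpace ℝ V]
    {f : X → V →L[ℝ] V} {g : X → Fin (m + 1) → ℝ} (hf : ContinuousAt f x)
    (hg : ContinuousAt g x) : ContinuousAt (fun t => revPoly (f t) (g t)) x :=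
  ContinuousAt.comp (g := fun p : (V →L[ℝ] V) × (Fin (m + 1) → ℝ) => _root_.revPoly p.1 p.2)
    contDiff_revPoly.continuous.continuousAt (hf.prodMk hg)

@[fun_prop]
theorem ContinuousAt.clm_prod {U V W : Type*}
    [NormedAddCommGroup U] [NormedSpace ℝ U] [NormedAddCommGroup V] [NormedSpace ℝ V]
    [NormedAddCommGroup W] [NormedSpace ℝ W] {f : X → U →L[ℝ] V} {g : X → U →L[ℝ] W}
    (hf : ContinuousAt f x) (hg : ContinuousAt g x) :
    ContinuousAt (fun t => (f t).prod (g t)) x := by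
  have e : (fun t => (f t).prod (g t)) = fun t =>
      (ContinuousLinearMap.inl ℝ V W).comp (f t) + (ContinuousLinearMap.inr ℝ V W).comp (g t) := by
    funext t
    ext u <;> simp
  rw [e]
  fun_prop

@[fun_prop]
theorem ContinuousAt.coeffBlock {c c' : X → Fin (m + 1) → ℝ} (hc : ContinuousAt c x)
    (hc' : ContinuousAt c' x) : ContinuousAt (fun t => coeffBlock (c t) (c' t)) x := by
  unfold _root_.coeffBlock
  fun_prop

@[fun_prop]
theorem ContinuousAt.scaledBlock {V : Type*} [NormedAddCommGroup V] [NormedSpace ℝ V]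
    {ε : X → ℝ} {M N : X → V →L[ℝ] V} (hε : ContinuousAt ε x) (hM : ContinuousAt M x)
    (hN : ContinuousAt N x) : ContinuousAt (fun t => scaledBlock (ε t) (M t) (N t)) x := by
  unfold _root_.scaledBlock
  fun_prop

/-- The series converge at `X` and their sums are continuous there. -/
def SeriesRegular {V : Type*} [NormedAddCommGroup V] [NormedSpace ℝ V]
    (a : Fin (m + 1) → ℕ → ℝ) (X : V →L[ℝ] V) : Prop :=
  SeriesConverge a X ∧ ∀ i, ContinuousAt (powerSum (a i)) X

variable {a : Fin (m + 1) → ℕ → ℝ}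

theorem eventually_seriesRegular (ha : ∀ i, 0 < (FormalMultilinearSeries.ofScalars ℝ (a i)).radius)
    {V : Type*} [NormedAddCommGroup V] [NormedSpace ℝ V] [CompleteSpace V] [Nontrivial V] :
    ∀ᶠ X in 𝓝 (0 : V →L[ℝ] V), SeriesRegular a X :=
  (eventually_all.2 fun i => eventually_hasSum_powerSum (ha i)).and
    (eventually_all.2 fun i => eventually_continuousAt_powerSum (ha i))

theorem eventually_seriesRegular_comp
    (ha : ∀ i, 0 < (FormalMultilinearSeries.ofScalars ℝ (a i)).radius)
    {V : Type*} [NormedAddCommGroup V] [NormedSpace ℝ V] [CompleteSpace V] [Nontrivial V]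
    {F : X → V →L[ℝ] V} (hF : ContinuousAt F x) (hx : F x = 0) :
    ∀ᶠ t in 𝓝 x, SeriesRegular a (F t) :=
  (hx ▸ hF : Tendsto F (𝓝 x) (𝓝 0)).eventually (eventually_seriesRegular ha)

theorem SeriesRegular.continuousAt_comp {V : Type*} [NormedAddCommGroup V] [NormedSpace ℝ V]
    {F : X → V →L[ℝ] V} (h : SeriesRegular a (F x)) (hF : ContinuousAt F x) (i : Fin (m + 1)) :
    ContinuousAt (fun t => powerSum (a i) (F t)) x :=
  ContinuousAt.comp (h.2 i) hF

theorem ContinuousAt.coeffQuotient {y c c' : X → Fin (m + 1) → ℝ} (hy : ContinuousAt y x)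
    (hc : ContinuousAt c x) (hc' : ContinuousAt c' x)
    (h : SeriesRegular a (_root_.revPoly (_root_.coeffBlock (c x) (c' x)) (y x))) :
    ContinuousAt (fun t => coeffQuotient a (y t) (c t) (c' t)) x := by
  have key := h.continuousAt_comp
    (F := fun t => _root_.revPoly (_root_.coeffBlock (c t) (c' t)) (y t)) (by fun_prop)
  unfold _root_.coeffQuotient
  fun_prop

theorem ContinuousAt.argQuotient {ε : ℝ} {w y c : X → Fin (m + 1) → ℝ} (hw : ContinuousAt w x)
    (hy : ContinuousAt y x) (hc : ContinuousAt c x) (h : SeriesRegular a (_root_.scaledBlock ε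
      (_root_.revPoly (_root_.companionOp (c x)) (w x))
      (_root_.revPoly (_root_.companionOp (c x)) (y x)))) :
    ContinuousAt (fun t => argQuotient a ε (w t) (y t) (c t)) x := by
  have key := h.continuousAt_comp (F := fun t => _root_.scaledBlock ε
      (_root_.revPoly (_root_.companionOp (c t)) (w t))
      (_root_.revPoly (_root_.companionOp (c t)) (y t))) (by fun_prop)
  unfold _root_.argQuotient
  fun_prop

theorem reducedCoeffs_zero (c : Fin (m + 1) → ℝ) : reducedCoeffs a 0 c = fun i => a i 0 := by
  ext j
  simp [reducedCoeffs, revPoly_zero, powerSum_zero, Pi.single_apply]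

theorem coeffQuotient_zero (c c' : Fin (m + 1) → ℝ) : coeffQuotient a 0 c c' = 0 := by
  simp [coeffQuotient, revPoly_zero, powerSum_zero]

theorem contDiffAt_reducedCoeffs
    (ha : ∀ i, 0 < (FormalMultilinearSeries.ofScalars ℝ (a i)).radius) (c : Fin (m + 1) → ℝ) :
    ContDiffAt ℝ ω (fun p : (Fin (m + 1) → ℝ) × (Fin (m + 1) → ℝ) => reducedCoeffs a p.1 p.2)
      (0, c) := by
  have hc : ContDiff ℝ ω fun p : (Fin (m + 1) → ℝ) × (Fin (m + 1) → ℝ) =>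
      revPoly (companionOp p.2) p.1 :=
    contDiff_revPoly.comp ((contDiff_companionOp.comp contDiff_snd).prodMk contDiff_fst)
  have key : ∀ i, ContDiffAt ℝ ω (fun p : (Fin (m + 1) → ℝ) × (Fin (m + 1) → ℝ) =>
      powerSum (a i) (revPoly (companionOp p.2) p.1)) (0, c) := by
    intro i
    refine ContDiffAt.comp (0, c) (g := powerSum (a i)) ?_ hc.contDiffAt
    rw [revPoly_zero]
    exact contDiffAt_powerSum (ha i)
  unfold reducedCoeffs
  fun_prop

/-- On bounded sets of coefficients and for small `x`, everything converges and `reducedCoeffs` is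
a contraction. -/
theorem eventually_contraction
    (ha : ∀ i, 0 < (FormalMultilinearSeries.ofScalars ℝ (a i)).radius) (R : ℝ) :
    ∀ᶠ x in 𝓝 (0 : Fin (m + 1) → ℝ), ∀ p ∈ Metric.closedBall (0 : Fin (m + 1) → ℝ) R ×ˢ
        Metric.closedBall (0 : Fin (m + 1) → ℝ) R,
      SeriesRegular a (revPoly (companionOp p.1) x) ∧
      SeriesRegular a (revPoly (companionOp p.2) x) ∧
      SeriesRegular a (revPoly (coeffBlock p.1 p.2) x) ∧
      ‖revPoly (companionOp p.2) (coeffQuotient a x p.1 p.2)‖ < 1 := by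
  -- Compactness of the product of balls makes one neighbourhood of x = 0 serve all pairs of
  -- coefficient vectors.
  refine ((isCompact_closedBall _ _).prod
    (isCompact_closedBall _ _)).eventually_forall_of_forall_eventually fun p _ => ?_
  have h3 : ∀ᶠ z in 𝓝 ((0 : Fin (m + 1) → ℝ), p),
      SeriesRegular a (revPoly (coeffBlock z.2.1 z.2.2) z.1) :=
    eventually_seriesRegular_comp ha
      (by fun_prop) (revPoly_zero _)
  have h3' := h3.self_of_nhds
  have hQ : ContinuousAt (fun z : (Fin (m + 1) → ℝ) × (Fin (m + 1) → ℝ) × (Fin (m + 1) → ℝ) =>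
      coeffQuotient a z.1 z.2.1 z.2.2) (0, p) :=
    ContinuousAt.coeffQuotient (by fun_prop) (by fun_prop) (by fun_prop) h3'
  have hS : ContinuousAt (fun z : (Fin (m + 1) → ℝ) × (Fin (m + 1) → ℝ) × (Fin (m + 1) → ℝ) =>
      companionOp z.2.2) (0, p) := by fun_prop
  have h4 := (hS.revPoly hQ).norm
  have h1 : ∀ᶠ z in 𝓝 ((0 : Fin (m + 1) → ℝ), p),
      SeriesRegular a (revPoly (companionOp z.2.1) z.1) :=
    eventually_seriesRegular_comp ha
      (by fun_prop) (revPoly_zero _)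
  have h2 : ∀ᶠ z in 𝓝 ((0 : Fin (m + 1) → ℝ), p),
      SeriesRegular a (revPoly (companionOp z.2.2) z.1) :=
    eventually_seriesRegular_comp ha
      (by fun_prop) (revPoly_zero _)
  -- The divided difference vanishes at x = 0, so its norm stays below 1 nearby by continuity.
  have h0 : ‖revPoly (companionOp p.2) (coeffQuotient a 0 p.1 p.2)‖ < 1 := by
    simp [coeffQuotient_zero, revPoly_zero]
  have h5 := h4.eventually (gt_mem_nhds h0)
  filter_upwards [h1, h2, h3, h5] with z g1 g2 g3 g5
  exact ⟨g1, g2, g3, g5⟩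

theorem eq_zero_of_apply_eq_self {V : Type*} [NormedAddCommGroup V] [NormedSpace ℝ V] {T : V →L[ℝ] V}
    (hT : ‖T‖ < 1) {u : V} (hu : T u = u) : u = 0 := by
  by_contra h
  have h1 := T.le_opNorm u
  rw [hu] at h1
  have h2 := norm_pos_iff.2 h
  nlinarith

theorem eventually_fixed_point_unique
    (ha : ∀ i, 0 < (FormalMultilinearSeries.ofScalars ℝ (a i)).radius) (R : ℝ) :
    ∀ᶠ x in 𝓝 (0 : Fin (m + 1) → ℝ), ∀ c c', ‖c‖ ≤ R → ‖c'‖ ≤ R →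
      c = reducedCoeffs a x c → c' = reducedCoeffs a x c' → c = c' := by
  filter_upwards [eventually_contraction ha R] with x hx c c' hc hc' h h'
  obtain ⟨h1, h2, h3, h4⟩ := hx (c, c') ⟨by simpa using hc, by simpa using hc'⟩
  have e := reducedCoeffs_sub h1.1 h2.1 h3.1
  rw [← h, ← h'] at e
  exact (sub_eq_zero.1 (eq_zero_of_apply_eq_self h4 e.symm)).symm

end Continuity

/-! ### The analytic solution and its differential equations -/

section Solution

variable {m : ℕ} {a : Fin (m + 1) → ℕ → ℝ}

theorem exists_analytic_fixed_point
    (ha : ∀ i, 0 < (FormalMultilinearSeries.ofScalars ℝ (a i)).radius) :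
    ∃ f : (Fin (m + 1) → ℝ) → Fin (m + 1) → ℝ, AnalyticAt ℝ f 0 ∧ (f 0 = fun i => a i 0) ∧
      ∀ᶠ x in 𝓝 0, f x = reducedCoeffs a x (f x) := by
  let V := Fin (m + 1) → ℝ
  let c₀ : V := fun i => a i 0
  let F : V × V → V := fun p => p.2 - reducedCoeffs a p.1 p.2
  have hF : ContDiffAt ℝ ω F (0, c₀) := contDiffAt_snd.sub (contDiffAt_reducedCoeffs ha c₀)
  -- At x = 0 the reduced coefficients are constant in c, so the partial derivative of F in c is the
  -- identity.
  have hD : fderiv ℝ F (0, c₀) ∘L .inr ℝ V V = ContinuousLinearMap.id ℝ V := by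
    have h1 : HasFDerivAt (fun c : V => F (0, c)) (fderiv ℝ F (0, c₀) ∘L .inr ℝ V V) c₀ :=
      HasFDerivAt.comp (g := F) (f := fun c : V => ((0 : V), c)) c₀
        (hF.differentiableAt (by simp)).hasFDerivAt (hasFDerivAt_prodMk_right 0 c₀)
    have h2 : HasFDerivAt (fun c : V => F (0, c)) (ContinuousLinearMap.id ℝ V) c₀ := by
      have e : (fun c : V => F (0, c)) = fun c => c - c₀ := by
        funext c
        simp only [F, reducedCoeffs_zero, c₀]
      rw [e]
      exact (hasFDerivAt_id c₀).sub_const c₀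
    exact h1.unique h2
  have hI : (fderiv ℝ F (0, c₀) ∘L .inr ℝ V V).IsInvertible :=
    ⟨ContinuousLinearEquiv.refl ℝ V, by rw [hD]; rfl⟩
  refine ⟨hF.implicitFunction (by simp) hI, ?_, hF.implicitFunction_apply_self (by simp) hI, ?_⟩
  · exact (hF.contDiffAt_implicitFunction (by simp) hI).analyticAt
  · filter_upwards [hF.eventually_apply_implicitFunction (by simp) hI] with x hx
    have h0 : F (0, c₀) = 0 := by simp only [F, reducedCoeffs_zero, c₀, sub_self]
    rw [h0] at hx
    exact sub_eq_zero.1 hx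

/-- The linear equation for the partial derivatives of a family of fixed points. -/
theorem fderiv_fixed_point {f : (Fin (m + 1) → ℝ) → Fin (m + 1) → ℝ} {x : Fin (m + 1) → ℝ}
    (hf : DifferentiableAt ℝ f x) {ε : ℝ} (hε : ε ≠ 0)
    (hfix : ∀ᶠ y in 𝓝 x, f y = reducedCoeffs a y (f y))
    (h₁ : ∀ᶠ y in 𝓝 x, SeriesConverge a (revPoly (companionOp (f x)) y))
    (h₂ : ∀ᶠ y in 𝓝 x, SeriesConverge a (revPoly (companionOp (f y)) y))
    (h₃ : ∀ᶠ y in 𝓝 x, SeriesConverge a (revPoly (coeffBlock (f x) (f y)) y))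
    (h₄ : ∀ᶠ y in 𝓝 x, SeriesConverge a (scaledBlock ε (revPoly (companionOp (f x)) x)
      (revPoly (companionOp (f x)) y)))
    (hc : ContinuousAt (fun y => coeffQuotient a y (f x) (f y)) x)
    (hk : ContinuousAt (fun y => argQuotient a ε x y (f x)) x) (j : Fin (m + 1)) :
    fderiv ℝ f x (Pi.single j 1) =
      revPoly (companionOp (f x)) (coeffQuotient a x (f x) (f x)) (fderiv ℝ f x (Pi.single j 1)) +
      (companionOp (f x) ^ (m - (j : ℕ))) (argQuotient a ε x x (f x)) := by
  let γ : ℝ → Fin (m + 1) → ℝ := fun t => x + t • Pi.single j 1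
  have hγ0 : γ 0 = x := by simp [γ]
  have hγc : Continuous γ := by fun_prop
  have hγ : Tendsto γ (𝓝[≠] 0) (𝓝 x) :=
    (hγ0 ▸ hγc.tendsto 0 : Tendsto γ (𝓝 0) (𝓝 x)).mono_left nhdsWithin_le_nhds
  have hd : Tendsto (fun t : ℝ => t⁻¹ • (f (γ t) - f x)) (𝓝[≠] 0)
      (𝓝 (fderiv ℝ f x (Pi.single j 1))) :=
    (hf.hasFDerivAt.hasLineDerivAt (Pi.single j 1)).tendsto_slope_zero
  have hT : Tendsto (fun t => revPoly (companionOp (f (γ t))) (coeffQuotient a (γ t) (f x) (f (γ t))))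
      (𝓝[≠] 0) (𝓝 (revPoly (companionOp (f x)) (coeffQuotient a x (f x) (f x)))) := by
    have : ContinuousAt (fun y => revPoly (companionOp (f y)) (coeffQuotient a y (f x) (f y))) x :=
      ContinuousAt.revPoly (ContinuousAt.companionOp hf.continuousAt) hc
    exact this.tendsto.comp hγ
  have hK : Tendsto (fun t => (companionOp (f x) ^ (m - (j : ℕ))) (argQuotient a ε x (γ t) (f x)))
      (𝓝[≠] 0) (𝓝 ((companionOp (f x) ^ (m - (j : ℕ))) (argQuotient a ε x x (f x)))) :=
    ((companionOp (f x) ^ (m - (j : ℕ))).continuous.tendsto _).comp (hk.tendsto.comp hγ)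
  have hTd := (isBoundedBilinearMap_apply (𝕜 := ℝ) (E := Fin (m + 1) → ℝ)
    (F := Fin (m + 1) → ℝ)).continuous.continuousAt.tendsto.comp (hT.prodMk_nhds hd)
  refine tendsto_nhds_unique hd ((hTd.add hK).congr' ?_)
  filter_upwards [hγ.eventually hfix, hγ.eventually h₁, hγ.eventually h₂, hγ.eventually h₃,
    hγ.eventually h₄, self_mem_nhdsWithin] with t gfix g₁ g₂ g₃ g₄ ht
  have e1 := reducedCoeffs_sub g₁ g₂ g₃
  have e2 := reducedCoeffs_sub_arg hε h₁.self_of_nhds g₁ g₄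
  rw [← gfix] at e1
  rw [← hfix.self_of_nhds] at e2
  have e3 : γ t - x = Pi.single j t := by
    rw [show γ t = x + t • Pi.single j 1 from rfl, add_sub_cancel_left, ← Pi.single_smul]
    simp
  rw [e3, revPoly_single, smul_apply] at e2
  -- Vary the coefficients first at the fixed argument γ t, then the argument at the fixed
  -- coefficients f x; each part is an exact divided difference.
  have e4 : f (γ t) - f x = (f (γ t) - reducedCoeffs a (γ t) (f x)) +
      (reducedCoeffs a (γ t) (f x) - f x) := by abel
  have ht' : t ≠ 0 := ht
  conv_rhs => rw [e4, e1, e2, smul_add, smul_smul, inv_mul_cancel₀ ht', one_smul]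
  simp

/-- At zero arguments the block reduces to its off-diagonal entry ε, which must be small to enter
the region of convergence yet nonzero to be divided out. Joint continuity at ε = 0 supplies such an
ε. -/
theorem exists_seriesRegular_scaledBlock
    (ha : ∀ i, 0 < (FormalMultilinearSeries.ofScalars ℝ (a i)).radius) (c : Fin (m + 1) → ℝ) :
    ∃ ε : ℝ, ε ≠ 0 ∧ ∀ᶠ p in 𝓝 ((0 : Fin (m + 1) → ℝ), (0 : Fin (m + 1) → ℝ), c),
      SeriesRegular a (scaledBlock ε (revPoly (companionOp p.2.2) p.1)
        (revPoly (companionOp p.2.2) p.2.1)) := by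
  have h : ∀ᶠ p in 𝓝 ((0 : ℝ), (0 : Fin (m + 1) → ℝ), (0 : Fin (m + 1) → ℝ), c), SeriesRegular a
      (scaledBlock p.1 (revPoly (companionOp p.2.2.2) p.2.1)
        (revPoly (companionOp p.2.2.2) p.2.2.1)) := by
    refine eventually_seriesRegular_comp ha (by fun_prop) ?_
    simp only [revPoly_zero]
    ext u <;> simp [scaledBlock]
  obtain ⟨ε, h1, h2⟩ := ((h.curry_nhds.filter_mono nhdsWithin_le_nhds).and
    (self_mem_nhdsWithin : ∀ᶠ ε in 𝓝[≠] (0 : ℝ), ε ∈ ({0}ᶜ : Set ℝ))).exists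
  exact ⟨ε, h2, h1⟩

/-- Applying S to the equation for w shows that S w solves the equation for u, whose solution is
unique because T is a contraction. -/
theorem eq_apply_of_linear_equations {V : Type*} [NormedAddCommGroup V] [NormedSpace ℝ V]
    {S T : V →L[ℝ] V} (hST : Commute S T) (hT : ‖T‖ < 1) {k : ℕ} {u w z : V}
    (hu : u = T u + (S ^ (k + 1)) z) (hw : w = T w + (S ^ k) z) : u = S w := by
  have h1 : S w = T (S w) + (S ^ (k + 1)) z := by
    conv_lhs => rw [hw]
    rw [map_add, pow_succ', mul_apply_eq_comp]
    exact congrArg (· + _) (DFunLike.congr_fun hST.eq w)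
  refine sub_eq_zero.1 (eq_zero_of_apply_eq_self hT ?_)
  rw [map_sub]
  conv_rhs => rw [hu, h1]
  abel

theorem eventually_norm_coeffQuotient_lt
    (ha : ∀ i, 0 < (FormalMultilinearSeries.ofScalars ℝ (a i)).radius)
    {f : (Fin (m + 1) → ℝ) → Fin (m + 1) → ℝ} (hf : ContinuousAt f 0) :
    ∀ᶠ x in 𝓝 0, ‖revPoly (companionOp (f x)) (coeffQuotient a x (f x) (f x))‖ < 1 := by
  have hb : ∀ᶠ x in 𝓝 (0 : Fin (m + 1) → ℝ), ‖f x‖ < ‖f 0‖ + 1 :=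
    hf.norm.eventually (gt_mem_nhds (lt_add_one _))
  filter_upwards [hb, eventually_contraction ha (‖f 0‖ + 1)] with x hx hc
  have hm : f x ∈ Metric.closedBall (0 : Fin (m + 1) → ℝ) (‖f 0‖ + 1) := by simpa using hx.le
  exact (hc (f x, f x) ⟨hm, hm⟩).2.2.2

theorem fderiv_fixed_point_eq_companionOp {f : (Fin (m + 1) → ℝ) → Fin (m + 1) → ℝ}
    {x : Fin (m + 1) → ℝ} (hf : DifferentiableAt ℝ f x) {ε : ℝ} (hε : ε ≠ 0)
    (hfix : ∀ᶠ y in 𝓝 x, f y = reducedCoeffs a y (f y))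
    (hN : ‖revPoly (companionOp (f x)) (coeffQuotient a x (f x) (f x))‖ < 1)
    (hS : ∀ᶠ p in 𝓝 (x, f x), SeriesRegular a (revPoly (companionOp p.2) p.1))
    (hB : ∀ᶠ p in 𝓝 (x, f x, f x), SeriesRegular a (revPoly (coeffBlock p.2.1 p.2.2) p.1))
    (hE : ∀ᶠ p in 𝓝 (x, x, f x), SeriesRegular a (scaledBlock ε
      (revPoly (companionOp p.2.2) p.1) (revPoly (companionOp p.2.2) p.2.1))) (j : Fin m) :
    fderiv ℝ f x (Pi.single j.castSucc 1) =
      companionOp (f x) (fderiv ℝ f x (Pi.single j.succ 1)) := by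
  have cf : Tendsto f (𝓝 x) (𝓝 (f x)) := hf.continuousAt
  have c1 : Tendsto (fun y => (y, f x)) (𝓝 x) (𝓝 (x, f x)) :=
    tendsto_id.prodMk_nhds tendsto_const_nhds
  have c2 : Tendsto (fun y => (y, f y)) (𝓝 x) (𝓝 (x, f x)) := tendsto_id.prodMk_nhds cf
  have c3 : Tendsto (fun y => (y, f x, f y)) (𝓝 x) (𝓝 (x, f x, f x)) :=
    tendsto_id.prodMk_nhds (tendsto_const_nhds.prodMk_nhds cf)
  have c4 : Tendsto (fun y => (x, y, f x)) (𝓝 x) (𝓝 (x, x, f x)) :=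
    tendsto_const_nhds.prodMk_nhds (tendsto_id.prodMk_nhds tendsto_const_nhds)
  have h1 : ∀ᶠ y in 𝓝 x, SeriesConverge a (revPoly (companionOp (f x)) y) :=
    (c1.eventually hS).mono fun _ h => h.1
  have h2 : ∀ᶠ y in 𝓝 x, SeriesConverge a (revPoly (companionOp (f y)) y) :=
    (c2.eventually hS).mono fun _ h => h.1
  have h3 : ∀ᶠ y in 𝓝 x, SeriesConverge a (revPoly (coeffBlock (f x) (f y)) y) :=
    (c3.eventually hB).mono fun _ h => h.1
  have h4 : ∀ᶠ y in 𝓝 x, SeriesConverge a (scaledBlock ε (revPoly (companionOp (f x)) x)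
      (revPoly (companionOp (f x)) y)) :=
    (c4.eventually hE).mono fun _ h => h.1
  have hBx := hB.self_of_nhds
  have hEx := hE.self_of_nhds
  have hc : ContinuousAt (fun y => coeffQuotient a y (f x) (f y)) x :=
    ContinuousAt.coeffQuotient continuousAt_id continuousAt_const hf.continuousAt hBx
  have hk : ContinuousAt (fun y => argQuotient a ε x y (f x)) x :=
    ContinuousAt.argQuotient continuousAt_const continuousAt_id continuousAt_const hEx
  have key := fderiv_fixed_point hf hε hfix h1 h2 h3 h4 hc hk
  have e : m - (j.castSucc : ℕ) = (m - (j.succ : ℕ)) + 1 := by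
    have := j.2
    simp; omega
  have k1 := key j.castSucc
  rw [e] at k1
  -- T is a polynomial in the companion operator at f x, hence commutes with it; consecutive j
  -- differ by one power of that operator.
  exact eq_apply_of_linear_equations ((Commute.refl _).revPoly_right _) hN k1 (key j.succ)

/-- The partial derivatives satisfy `∂f/∂x_j = S ∂f/∂x_(j+1)` with `S = companionOp (f x)`. -/
theorem eventually_fderiv_fixed_point
    (ha : ∀ i, 0 < (FormalMultilinearSeries.ofScalars ℝ (a i)).radius)
    {f : (Fin (m + 1) → ℝ) → Fin (m + 1) → ℝ} (hf : AnalyticAt ℝ f 0)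
    (hfix : ∀ᶠ x in 𝓝 0, f x = reducedCoeffs a x (f x)) :
    ∀ᶠ x in 𝓝 0, DifferentiableAt ℝ f x ∧ ∀ j : Fin m, fderiv ℝ f x (Pi.single j.castSucc 1) =
      companionOp (f x) (fderiv ℝ f x (Pi.single j.succ 1)) := by
  obtain ⟨ε, hε, hE⟩ := exists_seriesRegular_scaledBlock ha (f 0)
  have cf : Tendsto f (𝓝 0) (𝓝 (f 0)) := hf.continuousAt
  have c2 : Tendsto (fun y => (y, f y)) (𝓝 0) (𝓝 (0, f 0)) := tendsto_id.prodMk_nhds cf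
  have c3 : Tendsto (fun y => (y, f y, f y)) (𝓝 0) (𝓝 (0, f 0, f 0)) :=
    tendsto_id.prodMk_nhds (cf.prodMk_nhds cf)
  have c4 : Tendsto (fun y => (y, y, f y)) (𝓝 0) (𝓝 (0, 0, f 0)) :=
    tendsto_id.prodMk_nhds (tendsto_id.prodMk_nhds cf)
  have hB : ∀ᶠ p in 𝓝 ((0 : Fin (m + 1) → ℝ), f 0, f 0),
      SeriesRegular a (revPoly (coeffBlock p.2.1 p.2.2) p.1) :=
    eventually_seriesRegular_comp ha
      (by fun_prop) (revPoly_zero _)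
  have hS : ∀ᶠ p in 𝓝 ((0 : Fin (m + 1) → ℝ), f 0),
      SeriesRegular a (revPoly (companionOp p.2) p.1) :=
    eventually_seriesRegular_comp ha
      (by fun_prop) (revPoly_zero _)
  have hN := eventually_norm_coeffQuotient_lt ha hf.continuousAt
  have hS' := c2.eventually hS.eventually_nhds
  have hB' := c3.eventually hB.eventually_nhds
  have hE' := c4.eventually hE.eventually_nhds
  filter_upwards [hf.eventually_analyticAt, hfix.eventually_nhds, hN, hS', hB', hE']
    with x gf gfix gN gS gB gE
  exact ⟨gf.differentiableAt,
    fderiv_fixed_point_eq_companionOp gf.differentiableAt hε gfix gN gS gB gE⟩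

theorem SolvesSystemAt.of_fderiv {f : (Fin (m + 1) → ℝ) → Fin (m + 1) → ℝ} {x : Fin (m + 1) → ℝ}
    (hf : DifferentiableAt ℝ f x) (h : ∀ j : Fin m, fderiv ℝ f x (Pi.single j.castSucc 1) =
      companionOp (f x) (fderiv ℝ f x (Pi.single j.succ 1))) : SolvesSystemAt f x := by
  have hp : ∀ i j, partialD f i j x = fderiv ℝ f x (Pi.single j 1) i := by
    intro i j
    rw [partialD, fderiv_apply hf]
    rfl
  intro j hj
  have hj' := h ⟨j, by omega⟩
  refine ⟨fun i hi => ?_, ?_⟩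
  · rw [hp, hp, hp]
    refine ((congrFun hj' (Fin.castSucc ⟨i, by omega⟩)).trans
      (companionOp_castSucc _ _ _)).trans ?_
    exact (add_comm _ _).trans (congrArg (· + _) (mul_comm _ _))
  · rw [hp, hp]
    exact ((congrFun hj' (Fin.last m)).trans (companionOp_last _ _)).trans (mul_comm _ _)

/-- Here M = t Id, so v_i(M) = v_i(t) Id and no reduction is needed, whatever c is. -/
theorem eventually_reducedCoeffs_single_last {v : Fin (m + 1) → ℝ → ℝ}
    (hv : ∀ i, AnalyticAt ℝ (v i) 0) :
    ∀ᶠ t in 𝓝 (0 : ℝ), ∀ c : Fin (m + 1) → ℝ, reducedCoeffs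
      (fun i k => iteratedDeriv k (v i) 0 / (k.factorial : ℝ)) (Pi.single (Fin.last m) t) c =
        fun i => v i t := by
  have hV : ∀ i, ∀ᶠ t in 𝓝 (0 : ℝ),
      HasSum (fun k => (iteratedDeriv k (v i) 0 / (k.factorial : ℝ)) • t ^ k) (v i t) := by
    intro i
    filter_upwards [(hv i).hasFPowerSeriesAt.eventually_hasSum] with t ht
    simpa [FormalMultilinearSeries.ofScalars_apply_eq, mul_comm] using ht
  filter_upwards [eventually_all.2 hV] with t ht c
  have e : ∀ i, powerSum (fun k => iteratedDeriv k (v i) 0 / (k.factorial : ℝ))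
      (revPoly (companionOp c) (Pi.single (Fin.last m) t)) = v i t • 1 := by
    intro i
    have h1 := (ht i).smul_const (1 : (Fin (m + 1) → ℝ) →L[ℝ] (Fin (m + 1) → ℝ))
    rw [← h1.tsum_eq, powerSum]
    simp [revPoly_single, smul_pow, smul_smul]
  ext j
  simp [reducedCoeffs, e, Pi.single_apply]

end Solution

/-! ### The main theorem -/

theorem theorem2 (n : ℕ) (hn : 1 ≤ n) (v : Fin n → ℝ → ℝ) (hv : ∀ i, AnalyticAt ℝ (v i) 0) :
    ∃ f : (Fin n → ℝ) → Fin n → ℝ,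
      -- `f_1, …, f_n` are real analytic in a neighbourhood of `x = 0`
      AnalyticAt ℝ f 0 ∧
      -- `gl`-regular matrices with characteristic coefficients `f(x)` solve the matrix relation
      (∀ᶠ x in 𝓝 (0 : Fin n → ℝ),
        (∃ L : Matrix (Fin n) (Fin n) ℝ, GLRegular L ∧ charCoeffs L = f x) ∧
        ∀ L : Matrix (Fin n) (Fin n) ℝ, GLRegular L → charCoeffs L = f x →
          MatrixRelation v x L) ∧
      -- uniqueness: in any prescribed bounded region and for all `x` close enough to `0`, the
      -- relation makes sense and forces the characteristic coefficients of `L` to be `f(x)`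
      (∀ R : ℝ, ∀ᶠ x in 𝓝 (0 : Fin n → ℝ),
        ∀ L : Matrix (Fin n) (Fin n) ℝ, GLRegular L → (∀ i, |charCoeffs L i| ≤ R) →
          (∀ i, ∃ B, IsMatrixValue (v i) (matM x L) B) ∧
          (MatrixRelation v x L → charCoeffs L = f x)) ∧
      -- the functions `f_i` solve the system of partial differential equations
      (∀ᶠ x in 𝓝 (0 : Fin n → ℝ), SolvesSystemAt f x) ∧
      -- the initial condition `f_i(0, …, 0, t) = v_i(t)`
      (∀ᶠ t in 𝓝 (0 : ℝ), ∀ i, f (lastAxis n t) i = v i t) := by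
  obtain ⟨m, rfl⟩ : ∃ m, n = m + 1 := ⟨n - 1, by omega⟩
  let a : Fin (m + 1) → ℕ → ℝ := fun i k => iteratedDeriv k (v i) 0 / (k.factorial : ℝ)
  have ha : ∀ i, 0 < (FormalMultilinearSeries.ofScalars ℝ (a i)).radius :=
    fun i => (hv i).hasFPowerSeriesAt.radius_pos
  obtain ⟨f, hf, -, hfix⟩ := exists_analytic_fixed_point ha
  have hbd : ∀ᶠ x in 𝓝 (0 : Fin (m + 1) → ℝ), ‖f x‖ < ‖f 0‖ + 1 :=
    hf.continuousAt.norm.eventually (gt_mem_nhds (lt_add_one _))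
  refine ⟨f, hf, ?_, fun R => ?_, ?_, ?_⟩
  · filter_upwards [hfix, hbd, eventually_contraction ha (‖f 0‖ + 1)] with x hx hb hc
    refine ⟨exists_glRegular_charCoeffs_eq (f x), fun L hL hLf => ?_⟩
    have hm : f x ∈ Metric.closedBall (0 : Fin (m + 1) → ℝ) (‖f 0‖ + 1) := by simpa using hb.le
    have hs := (hc (f x, f x) ⟨hm, hm⟩).1.1
    rw [← hLf] at hs hx
    exact (matrixRelation_iff hL hs).2 hx
  -- The radius `max R (‖f 0‖ + 1)` places both the coefficients of L and f x in one ball where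
  -- fixed points are unique.
  · filter_upwards [hfix, hbd, eventually_contraction ha R,
      eventually_fixed_point_unique ha (max R (‖f 0‖ + 1))] with x hx hb hc hu L hL hLR
    have hR : 0 ≤ R := (abs_nonneg _).trans (hLR 0)
    have hn : ‖charCoeffs L‖ ≤ R := (pi_norm_le_iff_of_nonneg hR).2 hLR
    have hm : charCoeffs L ∈ Metric.closedBall (0 : Fin (m + 1) → ℝ) R := by simpa using hn
    have hs := (hc (charCoeffs L, charCoeffs L) ⟨hm, hm⟩).1.1
    exact ⟨fun i => ⟨_, isMatrixValue_of_hasSum (hs i)⟩, fun hr =>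
      hu _ _ (hn.trans (le_max_left _ _)) (hb.le.trans (le_max_right _ _))
        ((matrixRelation_iff hL hs).1 hr) hx⟩
  · filter_upwards [eventually_fderiv_fixed_point ha hf hfix] with x hx
    exact SolvesSystemAt.of_fderiv hx.1 hx.2
  · have hl : ∀ t, lastAxis (m + 1) t = Pi.single (Fin.last m) t := by
      intro t
      ext k
      simp [lastAxis, Pi.single_apply, Fin.ext_iff]
    have ht : Tendsto (fun t : ℝ => (Pi.single (Fin.last m) t : Fin (m + 1) → ℝ)) (𝓝 0) (𝓝 0) := by
      have := (continuous_single (A := fun _ : Fin (m + 1) => ℝ) (Fin.last m)).tendsto 0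
      rwa [Pi.single_zero] at this
    filter_upwards [ht.eventually hfix, eventually_reducedCoeffs_single_last hv] with t h1 h2 i
    rw [hl, h1]
    exact congrFun (h2 _) i
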